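/- Let $d\ge 2$ and let $\Gamma=(V,L)$ be the Cayley tree of order $d$ (the infinite tree in which every vertex has exactly $d+1$ neighbours), with set of oriented edges $\vec L$. Let $Q:\mathbb Z\to(0,\infty)$ be a summable function with $Q(-j)=Q(j)$ for all $j$ (a symmetric transfer operator of a gradient interaction). A (spatially homogeneous, positive) boundary law for $Q$ is a function $\lambda:\mathbb Z\to(0,\infty)$ for which there is a constant $c>0$ such that $$\lambda(i)=c\Big(\sum_{j\in\mathbb Z}Q(i-j)\lambda(j)\Big)^d<\infty\qquad\text{for all } i\in\mathbb Z .$$ It is height-periodic with minimal period $q\ge 1$ if $q$ is the least positive integer with $\lambda(i+q)=\lambda(i)$ for all $i$; then $\lambda$ is also regarded as a function on $\mathbb Z_q=\mathbb Z/q\mathbb Z$. For such $\lambda$ put $Q_q(k)=\sum_{l\in k}Q(l)$ for $k\in\mathbb Z_q$ and, for $i,j,s\in\mathbb Z_q$ and $l\in\mathbb Z$, $$P'(i,j)=\frac{Q_q(i-j)\lambda(j)}{\sum_{s\in\mathbb Z_q}Q_q(i-s)\lambda(s)},\qquad \alpha(i)=\frac{\lambda(i)^{(d+1)/d}}{\sum_{s\in\mathbb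 Z_q}\lambda(s)^{(d+1)/d}},\qquad \rho^Q_q(l\mid s)=\mathbf 1_{\{l\in s\}}\frac{Q(l)}{Q_q(s)} .$$ The gradient Gibbs measure $\nu^{\lambda}$ associated with $\lambda$ is the unique probability measure on the space of gradient configurations $\{\eta\in\mathbb Z^{\vec L}:\eta_{(y,x)}=-\eta_{(x,y)}\}$ such that for every finite connected $\Lambda\subset V$, every $w\in\Lambda$ and every gradient configuration $\zeta$, $$\nu^{\lambda}\big(\eta_{(x,y)}=\zeta_{(x,y)}\ \text{for all } (x,y)\in\vec L \text{ with } x,y\in\Lambda\big)=\sum_{\sigma\in\mathbb Z_q^{\Lambda}}\alpha(\sigma_w)\prod_{(x,y)}P'(\sigma_x,\sigma_y)\,\rho^Q_q\big(\zeta_{(x,y)}\mid\sigma_y-\sigma_x\big),$$ where the product is over the edges of $\Lambda$, each taken once and oriented away from $w$. Theorem. Let $\lambda_{q_1}$ and $\lambda_{q_2}$ be two height-periodic boundary laws for $Q$ with minimal periods $q_1$ and $q_2$, respectively. If $\nu^{\lambda_{q_1}}=\nu^{\lambda_{q_2}}$, then $q_1=q_2$, and there are a cyclic permutation $\rho$ of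 $\mathbb Z_{q_1}$ (a rotation $k\mapsto k+s$ for some $s\in\mathbb Z_{q_1}$) and a constant $c>0$ such that $\lambda_{q_2}=c\,\lambda_{q_1}\circ\rho$. -/

import Mathlib

open MeasureTheory

set_option linter.unusedSectionVars false

namespace TreeGradient

noncomputable section

/-- The Cayley tree of order `d`: the infinite tree in which every vertex has `d + 1` neighbours. -/
def IsCayleyTree {V : Type*} (G : SimpleGraph V) [G.LocallyFinite] (d : ℕ) : Prop :=
  G.IsTree ∧ G.IsRegularOfDegree (d + 1)

/-- A symmetric, strictly positive transfer operator `Q(i - j)` of a gradient interaction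
on the local state space `ℤ`; `Q = exp (-β U)` with `U` an even function. -/
structure IsSymmTransferOperator (Q : ℤ → ℝ) : Prop where
  pos : ∀ j, 0 < Q j
  symm : ∀ j, Q (-j) = Q j

/-- Spatially homogeneous boundary laws for `Q` on the Cayley tree of order `d`, with strictly
positive entries: each of the `d` children contributes one factor `∑ j, Q (i - j) * lam j`. -/
structure IsBoundaryLaw (d : ℕ) (Q lam : ℤ → ℝ) : Prop where
  pos : ∀ i, 0 < lam i
  summable : ∀ i, Summable fun j : ℤ => Q (i - j) * lam j
  eqn : ∃ c : ℝ, 0 < c ∧ ∀ i, lam i = c * (∑' j : ℤ, Q (i - j) * lam j) ^ d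

/-- `lam` is height-periodic and `q ≥ 1` is its least positive period. -/
def HasMinimalPeriod (lam : ℤ → ℝ) (q : ℕ) : Prop :=
  0 < q ∧ Function.Periodic lam (q : ℤ) ∧
    ∀ p : ℕ, 0 < p → Function.Periodic lam (p : ℤ) → q ≤ p

/-- A `q`-periodic function on `ℤ`, seen as a function on the residue class ring. -/
def onResidues (q : ℕ) (lam : ℤ → ℝ) (k : ZMod q) : ℝ := lam (k.val : ℤ)

/-- `Q_q`, the sum of `Q` over a residue class modulo `q`. -/
def Qmod (Q : ℤ → ℝ) (q : ℕ) (k : ZMod q) : ℝ :=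
  ∑' l : ℤ, if (l : ZMod q) = k then Q l else 0

section

variable (d : ℕ) (Q : ℤ → ℝ) (q : ℕ) [NeZero q] (lam : ℤ → ℝ)

/-- Transition matrix of the fuzzy chain on `ℤ/qℤ`. -/
def fuzzyP (i j : ZMod q) : ℝ :=
  Qmod Q q (i - j) * onResidues q lam j / ∑ s : ZMod q, Qmod Q q (i - s) * onResidues q lam s

/-- Stationary distribution of the fuzzy chain, proportional to `lam ^ ((d + 1) / d)`. -/
def fuzzyStat (i : ZMod q) : ℝ :=
  onResidues q lam i ^ (((d : ℝ) + 1) / d) /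
    ∑ s : ZMod q, onResidues q lam s ^ (((d : ℝ) + 1) / d)

/-- The conditional law of the integer increment along an edge, given that the increment of the
fuzzy chain along this edge is the residue class `s`. -/
def incrLaw (j : ℤ) (s : ZMod q) : ℝ :=
  if (j : ZMod q) = s then Q j / Qmod Q q s else 0

end

/-- Gradient configurations: integer-valued functions on oriented edges that change sign
when the orientation is reversed. -/
abbrev GradConf {V : Type*} (G : SimpleGraph V) : Type _ :=
  {η : G.Dart → ℤ // ∀ e : G.Dart, η e.symm = -η e}

section

variable {V : Type*} (G : SimpleGraph V)

/-- Oriented edges with both end points in `Λ`. -/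
abbrev DartsIn (Λ : Finset V) : Type _ := (G.induce (Λ : Set V)).Dart

/-- The vertices in `Λ`. -/
abbrev VertIn {V : Type*} (Λ : Finset V) : Type _ := ↥(Λ : Set V)

/-- An oriented edge inside `Λ`, as an oriented edge of the whole tree. -/
def DartsIn.incl {G : SimpleGraph V} {Λ : Finset V} (e : DartsIn G Λ) : G.Dart :=
  ⟨((e.fst : V), (e.snd : V)), e.adj⟩

open Classical in
/-- The edges inside `Λ`, each one taken once, with the orientation that points away from `w`. -/
def outDarts (Λ : Finset V) (w : V) : Finset (DartsIn G Λ) :=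
  Finset.univ.filter fun e => G.dist w (e.snd : V) = G.dist w (e.fst : V) + 1

variable (d : ℕ) (Q : ℤ → ℝ) (q : ℕ) [NeZero q] (lam : ℤ → ℝ)

/-- The law of the tree-indexed fuzzy chain, restricted to a finite connected set `Λ` of vertices:
the state at `w ∈ Λ` is drawn from the stationary distribution, and the state is propagated along
the edges pointing away from `w` by the transition matrix. -/
def fuzzyMarginal (Λ : Finset V) (w : V) (hw : w ∈ Λ) (σ : VertIn Λ → ZMod q) : ℝ :=
  fuzzyStat d q lam (σ ⟨w, hw⟩) * ∏ e ∈ outDarts G Λ w, fuzzyP Q q lam (σ e.fst) (σ e.snd)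

open Classical in
/-- The finite-volume weights of the two-layer construction: first the fuzzy chain is sampled,
and then, independently over the edges, the integer increments given the fuzzy increments. -/
def gradMarginal (Λ : Finset V) (w : V) (hw : w ∈ Λ) (ζ : GradConf G) : ℝ :=
  ∑ σ : VertIn Λ → ZMod q, fuzzyMarginal G d Q q lam Λ w hw σ *
    ∏ e ∈ outDarts G Λ w, incrLaw Q q (ζ.1 e.incl) (σ e.snd - σ e.fst)

/-- The gradient configurations which agree with `ζ` on the edges inside `Λ`. -/
def gradCylinder (Λ : Finset V) (ζ : GradConf G) : Set (GradConf G) :=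
  {η | ∀ e : DartsIn G Λ, η.1 e.incl = ζ.1 e.incl}

/-- `ν` is a probability measure on gradient configurations whose finite-volume marginals are
given by the two-layer construction. -/
structure IsGradMeasure (ν : Measure (GradConf G)) : Prop where
  prob : IsProbabilityMeasure ν
  marginal : ∀ (Λ : Finset V) (w : V) (hw : w ∈ Λ), (G.induce (Λ : Set V)).Connected →
    ∀ ζ : GradConf G, ν.real (gradCylinder G Λ ζ) = gradMarginal G d Q q lam Λ w hw ζ

open Classical in
/-- The gradient Gibbs measure associated with the `q`-periodic boundary law `lam`: the
probability measure with the prescribed finite-volume marginals. Existence and uniqueness for every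
`q`-periodic boundary law `lam` are proved below. -/
def gradMeasure : Measure (GradConf G) :=
  if h : ∃ ν, IsGradMeasure G d Q q lam ν then h.choose else 0

end

/-- A cyclic permutation of the coordinates, that is, a rotation of `ℤ/qℤ`. -/
def IsCyclicShift {q : ℕ} (ρ : Equiv.Perm (ZMod q)) : Prop :=
  ∃ s : ZMod q, ∀ k, ρ k = k + s

section proofs1
variable {d : ℕ} {Q : ℤ → ℝ} {q : ℕ} [NeZero q] {lam : ℤ → ℝ}

/-! Existence and uniqueness of the gradient Gibbs measure. -/

theorem onResidues_intCast (hp : Function.Periodic lam (q : ℤ)) (i : ℤ) :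
    onResidues q lam (i : ZMod q) = lam i := by
  unfold onResidues
  rw [ZMod.val_intCast, Int.emod_def]
  have := hp.sub_zsmul_eq (x := i) (i / (q : ℤ))
  rw [← this]; congr 1; simp [mul_comm]

theorem summable_Qmod (hQ1 : Summable Q) (k : ZMod q) :
    Summable fun l : ℤ => if (l : ZMod q) = k then Q l else 0 := by
  have := hQ1.indicator {l : ℤ | (l : ZMod q) = k}
  exact this.congr fun l => by simp [Set.indicator]

theorem Qmod_pos (hQ : IsSymmTransferOperator Q) (hQ1 : Summable Q) (k : ZMod q) :
    0 < Qmod Q q k := by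
  refine (summable_Qmod hQ1 k).tsum_pos (fun l => ?_) (k.val : ℤ) ?_
  · split_ifs
    · exact (hQ.pos l).le
    · exact le_rfl
  · simpa using hQ.pos _

theorem Qmod_neg (hQ : IsSymmTransferOperator Q) (k : ZMod q) : Qmod Q q (-k) = Qmod Q q k := by
  unfold Qmod
  rw [← (Equiv.neg ℤ).tsum_eq]
  refine tsum_congr fun l => ?_
  simp [hQ.symm]

theorem incrLaw_neg (hQ : IsSymmTransferOperator Q) (l : ℤ) (s : ZMod q) :
    incrLaw Q q (-l) (-s) = incrLaw Q q l s := by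
  simp [incrLaw, Qmod_neg hQ, hQ.symm]

theorem incrLaw_nonneg (hQ : IsSymmTransferOperator Q) (hQ1 : Summable Q) (l : ℤ) (s : ZMod q) :
    0 ≤ incrLaw Q q l s := by
  unfold incrLaw
  split_ifs
  · exact div_nonneg (hQ.pos l).le (Qmod_pos hQ hQ1 s).le
  · exact le_rfl

theorem incrLaw_hasSum (hQ : IsSymmTransferOperator Q) (hQ1 : Summable Q) (s : ZMod q) :
    HasSum (fun l => incrLaw Q q l s) 1 := by
  have h := (summable_Qmod hQ1 s).hasSum.div_const (Qmod Q q s)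
  change HasSum _ (Qmod Q q s / Qmod Q q s) at h
  rw [div_self (Qmod_pos hQ hQ1 s).ne'] at h
  refine h.congr_fun fun l => ?_
  unfold incrLaw
  split_ifs <;> simp

theorem onResidues_pos (hb : IsBoundaryLaw d Q lam) (k : ZMod q) : 0 < onResidues q lam k :=
  hb.pos _

theorem fuzzySum_pos (hQ : IsSymmTransferOperator Q) (hQ1 : Summable Q)
    (hb : IsBoundaryLaw d Q lam) (i : ZMod q) :
    0 < ∑ s : ZMod q, Qmod Q q (i - s) * onResidues q lam s :=
  Finset.sum_pos (fun s _ => mul_pos (Qmod_pos hQ hQ1 _) (onResidues_pos hb s))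
    Finset.univ_nonempty

theorem fuzzyP_nonneg (hQ : IsSymmTransferOperator Q) (hQ1 : Summable Q)
    (hb : IsBoundaryLaw d Q lam) (i j : ZMod q) : 0 ≤ fuzzyP Q q lam i j :=
  div_nonneg (mul_pos (Qmod_pos hQ hQ1 _) (onResidues_pos hb j)).le (fuzzySum_pos hQ hQ1 hb i).le

theorem fuzzyP_sum (hQ : IsSymmTransferOperator Q) (hQ1 : Summable Q)
    (hb : IsBoundaryLaw d Q lam) (i : ZMod q) : ∑ j, fuzzyP Q q lam i j = 1 := by
  unfold fuzzyP
  rw [← Finset.sum_div, div_self (fuzzySum_pos hQ hQ1 hb i).ne']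

theorem fuzzyStat_den_pos (hb : IsBoundaryLaw d Q lam) :
    0 < ∑ s : ZMod q, onResidues q lam s ^ (((d : ℝ) + 1) / d) :=
  Finset.sum_pos (fun s _ => Real.rpow_pos_of_pos (onResidues_pos hb s) _) Finset.univ_nonempty

theorem fuzzyStat_nonneg (hb : IsBoundaryLaw d Q lam) (i : ZMod q) : 0 ≤ fuzzyStat d q lam i :=
  div_nonneg (Real.rpow_pos_of_pos (onResidues_pos hb i) _).le (fuzzyStat_den_pos hb).le

theorem fuzzyStat_sum (hb : IsBoundaryLaw d Q lam) : ∑ i, fuzzyStat d q lam i = 1 := by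
  unfold fuzzyStat
  rw [← Finset.sum_div, div_self (fuzzyStat_den_pos hb).ne']

theorem fuzzySum_eq (hQ1 : Summable Q) (hp : Function.Periodic lam (q : ℤ)) (i : ZMod q) :
    ∑ s : ZMod q, Qmod Q q (i - s) * onResidues q lam s
      = ∑' j : ℤ, Q ((i.val : ℤ) - j) * lam j := by
  have h : ∀ s : ZMod q, HasSum (fun l : ℤ => (if (l : ZMod q) = i - s then Q l else 0) *
      onResidues q lam s) (Qmod Q q (i - s) * onResidues q lam s) := fun s =>
    (summable_Qmod hQ1 _).hasSum.mul_right _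
  rw [← (hasSum_sum fun s (_ : s ∈ Finset.univ) => h s).tsum_eq,
    ← (Equiv.subLeft (i.val : ℤ)).tsum_eq (fun j : ℤ => Q ((i.val : ℤ) - j) * lam j)]
  refine tsum_congr fun l => ?_
  simp only [Equiv.subLeft_apply, sub_sub_cancel]
  rw [← onResidues_intCast hp, Finset.sum_eq_single (i - (l : ZMod q))]
  · simp
  · intro s _ hs
    rw [if_neg, zero_mul]
    rintro h
    exact hs (by rw [h]; ring)
  · simp

theorem detailed_balance (hd : 1 ≤ d) (hQ : IsSymmTransferOperator Q) (hQ1 : Summable Q)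
    (hb : IsBoundaryLaw d Q lam) (hp : Function.Periodic lam (q : ℤ)) (i j : ZMod q) :
    fuzzyStat d q lam i * fuzzyP Q q lam i j = fuzzyStat d q lam j * fuzzyP Q q lam j i := by
  obtain ⟨c, hc, he⟩ := hb.eqn
  have hd0 : (d : ℝ) ≠ 0 := by positivity
  have key : ∀ k : ZMod q, onResidues q lam k ^ (((d : ℝ) + 1) / d) =
      onResidues q lam k * (c ^ ((1 : ℝ) / d) *
        ∑ s : ZMod q, Qmod Q q (k - s) * onResidues q lam s) := by
    intro k
    have hk := onResidues_pos (q := q) hb k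
    have hS := fuzzySum_pos hQ hQ1 hb k
    rw [show ((d : ℝ) + 1) / d = 1 + 1 / d by field_simp, Real.rpow_add hk, Real.rpow_one]
    congr 1
    have : onResidues q lam k = c * (∑ s : ZMod q, Qmod Q q (k - s) * onResidues q lam s) ^ d := by
      rw [fuzzySum_eq hQ1 hp]; exact he _
    rw [this, Real.mul_rpow hc.le (by positivity), ← Real.rpow_natCast, ← Real.rpow_mul hS.le,
      mul_one_div_cancel hd0, Real.rpow_one]
  unfold fuzzyStat fuzzyP
  rw [key i, key j, show j - i = -(i - j) by ring, Qmod_neg hQ]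
  have h1 := (fuzzySum_pos hQ hQ1 hb i).ne'
  have h2 := (fuzzySum_pos hQ hQ1 hb j).ne'
  field_simp

end proofs1

section tree
variable {V : Type*} {G : SimpleGraph V}

theorem parent_unique (hG : G.IsTree) {w x x' y : V} (h : G.Adj x y) (h' : G.Adj x' y)
    (hd : G.dist w y = G.dist w x + 1) (hd' : G.dist w y = G.dist w x' + 1) : x = x' := by
  obtain ⟨p, hp, hl⟩ := hG.connected.exists_path_of_dist w x
  obtain ⟨p', hp', hl'⟩ := hG.connected.exists_path_of_dist w x'
  have a := (p.concat h).isPath_of_length_eq_dist (by simp [hl, hd])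
  have a' := (p'.concat h').isPath_of_length_eq_dist (by simp [hl', hd'])
  have := (hG.existsUnique_path w y).unique a a'
  simpa using congrArg SimpleGraph.Walk.penultimate this

theorem exists_parent (hG : G.IsTree) {s : Set V} (hs : (G.induce s).Connected) {w y : s}
    (h : y ≠ w) : ∃ x : s, G.Adj x y ∧ G.dist (w : V) y = G.dist (w : V) x + 1 := by
  obtain ⟨p, hp⟩ := (hs y w).exists_isPath
  cases p with
  | nil => exact absurd rfl h
  | @cons _ x _ hadj p' =>
    refine ⟨x, SimpleGraph.Adj.symm hadj, ?_⟩
    have hl : ∀ {a : s} (r : (G.induce s).Walk a w), r.IsPath → G.dist (w : V) a = r.length := by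
      intro a r hr
      obtain ⟨t, ht, htl⟩ := hG.connected.exists_path_of_dist (a : V) w
      have hm := SimpleGraph.Walk.IsPath.map
        (f := (SimpleGraph.Embedding.induce s).toHom) Subtype.val_injective hr
      have := (hG.existsUnique_path (a : V) w).unique ht hm
      rw [SimpleGraph.dist_comm, ← htl, this]; exact SimpleGraph.Walk.length_map _ _
    rw [hl _ hp, hl p' hp.of_cons]; simp

theorem out_swap (hG : G.IsTree) {w w' x y : V} (hw : G.Adj w w') (hxy : G.Adj x y)
    (h : G.dist w y = G.dist w x + 1) (hne : ¬ (x = w ∧ y = w')) :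
    G.dist w' y = G.dist w' x + 1 := by
  rcases hG.dist_eq_dist_add_one_of_adj w' hxy with h1 | h1
  swap
  · exact h1
  exfalso
  have a1 : ∀ z, G.dist w z = G.dist w' z + 1 ∨ G.dist w' z = G.dist w z + 1 := fun z => by
    simpa [SimpleGraph.dist_comm] using hG.dist_eq_dist_add_one_of_adj z hw
  have hyw : y ≠ w' := by
    rintro rfl
    apply hne
    refine ⟨?_, rfl⟩
    have h2 : G.dist w y = 1 := SimpleGraph.dist_eq_one_iff_adj.2 hw
    have h3 : G.dist w x = 0 := by omega
    exact (hG.connected.dist_eq_zero_iff.1 h3).symm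
  have hconn : (G.induce (Set.univ : Set V)).Connected :=
    (SimpleGraph.induceUnivIso G).connected_iff.2 hG.connected
  obtain ⟨⟨z, _⟩, hz1, hz2⟩ := exists_parent hG hconn (w := ⟨w', trivial⟩) (y := ⟨y, trivial⟩)
    (fun h => hyw (congrArg Subtype.val h))
  simp only at hz1 hz2
  have b1 := a1 y
  have b2 := a1 x
  have b3 := a1 z
  have b4 := hG.dist_eq_dist_add_one_of_adj w hz1
  have : x = z := parent_unique hG (w := w) hxy hz1 h (by omega)
  subst this
  omega

end tree
section swap
variable {V : Type*} {G : SimpleGraph V}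
variable {d : ℕ} {Q : ℤ → ℝ} {q : ℕ} [NeZero q] {lam : ℤ → ℝ}

open Classical in
theorem mem_outDarts {Λ : Finset V} {w : V} {e : DartsIn G Λ} :
    e ∈ outDarts G Λ w ↔ G.dist w (e.snd : V) = G.dist w (e.fst : V) + 1 := by
  simp [outDarts]

theorem outDarts_unique (hG : G.IsTree) {Λ : Finset V} {w : V} {e e' : DartsIn G Λ}
    (he : e ∈ outDarts G Λ w) (he' : e' ∈ outDarts G Λ w) (h : e.snd = e'.snd) : e = e' := by
  rw [mem_outDarts] at he he'
  have h1 : G.Adj (e.fst : V) e.snd := e.adj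
  have h2 : G.Adj (e'.fst : V) e.snd := by rw [h]; exact e'.adj
  rw [← h] at he'
  have := parent_unique hG h1 h2 he he'
  exact SimpleGraph.Dart.ext _ _ (Prod.ext (Subtype.ext this) h)

/-- Weight of a joint configuration of the fuzzy chain and the increments, rooted at `w`. -/
def wt (G : SimpleGraph V) (d : ℕ) (Q : ℤ → ℝ) (q : ℕ) [NeZero q] (lam : ℤ → ℝ) (Λ : Finset V)
    (ζ : GradConf G) (σ : VertIn Λ → ZMod q) (w : VertIn Λ) : ℝ :=
  fuzzyStat d q lam (σ w) * ∏ e ∈ outDarts G Λ (w : V),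
    (fuzzyP Q q lam (σ e.fst) (σ e.snd) * incrLaw Q q (ζ.1 e.incl) (σ e.snd - σ e.fst))

open Classical in
theorem gradMarginal_eq (Λ : Finset V) (w : V) (hw : w ∈ Λ) (ζ : GradConf G) :
    gradMarginal G d Q q lam Λ w hw ζ =
      ∑ σ : VertIn Λ → ZMod q, wt G d Q q lam Λ ζ σ ⟨w, hw⟩ := by
  refine Finset.sum_congr rfl fun σ _ => ?_
  rw [fuzzyMarginal, wt, Finset.prod_mul_distrib, mul_assoc]

open Classical in
theorem wt_swap (hG : G.IsTree) (hd : 1 ≤ d) (hQ : IsSymmTransferOperator Q) (hQ1 : Summable Q)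
    (hb : IsBoundaryLaw d Q lam) (hp : Function.Periodic lam (q : ℤ)) (Λ : Finset V)
    (ζ : GradConf G) (σ : VertIn Λ → ZMod q) {w w' : VertIn Λ}
    (h : (G.induce (Λ : Set V)).Adj w w') :
    wt G d Q q lam Λ ζ σ w = wt G d Q q lam Λ ζ σ w' := by
  have hadj : G.Adj (w : V) (w' : V) := h
  have hw1 : G.dist (w : V) w' = 1 := SimpleGraph.dist_eq_one_iff_adj.2 hadj
  have hw1' : G.dist (w' : V) w = 1 := SimpleGraph.dist_eq_one_iff_adj.2 hadj.symm
  let e0 : DartsIn G Λ := ⟨(w, w'), h⟩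
  have m0 : e0 ∈ outDarts G Λ (w : V) := by
    rw [mem_outDarts]; simp [e0, hw1]
  have m1 : e0.symm ∈ outDarts G Λ (w' : V) := by
    rw [mem_outDarts]; simp [e0, hw1']
  have hR : (outDarts G Λ (w : V)).erase e0 = (outDarts G Λ (w' : V)).erase e0.symm := by
    ext e
    have hs : ∀ (f : DartsIn G Λ) (a b : VertIn Λ) (hab : (G.induce (Λ : Set V)).Adj a b),
        ((f.fst : V) = a ∧ (f.snd : V) = b) → f = ⟨(a, b), hab⟩ := fun f a b hab hf =>
      SimpleGraph.Dart.ext _ _ (Prod.ext (Subtype.ext hf.1) (Subtype.ext hf.2))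
    simp only [Finset.mem_erase, mem_outDarts]
    constructor
    · rintro ⟨hne, ho⟩
      refine ⟨?_, out_swap hG hadj e.adj ho fun hf => hne (hs e w w' h hf)⟩
      rintro rfl
      simp [e0, hw1] at ho
    · rintro ⟨hne, ho⟩
      refine ⟨?_, out_swap hG hadj.symm e.adj ho fun hf => hne (hs e w' w h.symm hf)⟩
      rintro rfl
      simp [e0, hw1'] at ho
  unfold wt
  rw [← Finset.mul_prod_erase _ _ m0, ← Finset.mul_prod_erase _ _ m1, hR, ← mul_assoc, ← mul_assoc,
    ← mul_assoc, ← mul_assoc]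
  congr 1
  have a : ζ.1 (DartsIn.incl e0.symm) = - ζ.1 e0.incl := ζ.2 e0.incl
  rw [a]
  change fuzzyStat d q lam (σ w) * fuzzyP Q q lam (σ w) (σ w') *
    incrLaw Q q (ζ.1 e0.incl) (σ w' - σ w) = fuzzyStat d q lam (σ w') *
    fuzzyP Q q lam (σ w') (σ w) * incrLaw Q q (-ζ.1 e0.incl) (σ w - σ w')
  rw [detailed_balance hd hQ hQ1 hb hp, ← neg_sub (σ w') (σ w), incrLaw_neg hQ]

theorem wt_root (hG : G.IsTree) (hd : 1 ≤ d) (hQ : IsSymmTransferOperator Q) (hQ1 : Summable Q)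
    (hb : IsBoundaryLaw d Q lam) (hp : Function.Periodic lam (q : ℤ)) (Λ : Finset V)
    (hΛ : (G.induce (Λ : Set V)).Connected)
    (ζ : GradConf G) (σ : VertIn Λ → ZMod q) (w w' : VertIn Λ) :
    wt G d Q q lam Λ ζ σ w = wt G d Q q lam Λ ζ σ w' := by
  obtain ⟨p⟩ := hΛ w w'
  induction p with
  | nil => rfl
  | cons h _ ih => exact (wt_swap hG hd hQ hQ1 hb hp Λ ζ σ h).trans ih

theorem gradMarginal_root (hG : G.IsTree) (hd : 1 ≤ d) (hQ : IsSymmTransferOperator Q)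
    (hQ1 : Summable Q) (hb : IsBoundaryLaw d Q lam) (hp : Function.Periodic lam (q : ℤ))
    (Λ : Finset V) (hΛ : (G.induce (Λ : Set V)).Connected) (ζ : GradConf G) (w w' : V)
    (hw : w ∈ Λ) (hw' : w' ∈ Λ) :
    gradMarginal G d Q q lam Λ w hw ζ = gradMarginal G d Q q lam Λ w' hw' ζ := by
  rw [gradMarginal_eq, gradMarginal_eq]
  exact Finset.sum_congr rfl fun σ _ => wt_root hG hd hQ hQ1 hb hp Λ hΛ ζ σ _ _

/-- A probability measure on gradient configurations is determined by its values on the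
cylinders over the finite connected sets of vertices containing a given finite set. -/
theorem ext_gradCylinder (hG : G.IsTree) (F : Finset V) (hF : F.Nonempty)
    (μ ν : Measure (GradConf G)) [IsProbabilityMeasure μ] [IsProbabilityMeasure ν]
    (h : ∀ Λ : Finset V, F ⊆ Λ → (G.induce (Λ : Set V)).Connected → ∀ ζ : GradConf G,
      μ.real (gradCylinder G Λ ζ) = ν.real (gradCylinder G Λ ζ)) : μ = ν := by
  classical
  -- it is enough to compare the laws of the configurations as functions on all darts
  suffices hs : μ.map Subtype.val = ν.map Subtype.val by
    ext s hs'
    obtain ⟨t, ht, rfl⟩ := hs'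
    rw [← Measure.map_apply measurable_subtype_coe ht, hs,
      Measure.map_apply measurable_subtype_coe ht]
  have hfin : ∀ I : Finset G.Dart, IsFiniteMeasure
      ((ν.map (Subtype.val : GradConf G → G.Dart → ℤ)).map (I.restrict (π := fun _ => ℤ))) :=
    fun I => inferInstance
  refine IsProjectiveLimit.unique (P := fun I => (ν.map Subtype.val).map I.restrict) ?_
    (fun I => rfl)
  · intro I
    have mr : ∀ J : Finset G.Dart, Measurable (J.restrict (π := fun _ => ℤ)) := fun J =>
      Finset.measurable_restrict J
    obtain ⟨Λ, hΛ, hc⟩ := SimpleGraph.extend_finset_to_connected hG.connected.preconnected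
      (t := F ∪ I.image (fun e => e.fst) ∪ I.image (fun e => e.snd)) (by
        obtain ⟨x, hx⟩ := hF
        exact ⟨x, by simp [hx]⟩)
    let r : GradConf G → DartsIn G Λ → ℤ := fun η e => η.1 e.incl
    have hr : Measurable r := by
      refine measurable_pi_iff.2 fun e => ?_
      exact (measurable_pi_apply _).comp measurable_subtype_coe
    have hreq : μ.map r = ν.map r := by
      refine Measure.ext_of_singleton fun z => ?_
      rw [Measure.map_apply hr (measurableSet_singleton _),
        Measure.map_apply hr (measurableSet_singleton _)]
      by_cases hz : ∃ ζ : GradConf G, r ζ = z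
      · obtain ⟨ζ, rfl⟩ := hz
        have : r ⁻¹' {r ζ} = gradCylinder G Λ ζ := by
          ext η
          simp [gradCylinder, r, funext_iff]
        rw [this]
        refine (measureReal_eq_measureReal_iff).1 (h Λ ?_ hc ζ)
        intro x hx
        exact hΛ (by simp [hx])
      · have : r ⁻¹' {z} = ∅ := by
          ext η
          simp only [Set.mem_preimage, Set.mem_singleton_iff, Set.mem_empty_iff_false, iff_false]
          exact fun hη => hz ⟨η, hη⟩
        rw [this]; simp
    have hI : ∀ e : I, ∃ f : DartsIn G Λ, f.incl = e.1 := by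
      rintro ⟨e, he⟩
      have h1 : e.fst ∈ Λ := hΛ (by
        simp only [Finset.mem_union, Finset.mem_image]
        exact Or.inl (Or.inr ⟨e, he, rfl⟩))
      have h2 : e.snd ∈ Λ := hΛ (by
        simp only [Finset.mem_union, Finset.mem_image]
        exact Or.inr ⟨e, he, rfl⟩)
      exact ⟨⟨(⟨e.fst, h1⟩, ⟨e.snd, h2⟩), e.adj⟩, rfl⟩
    choose g hg using hI
    let r2 : (DartsIn G Λ → ℤ) → (I → ℤ) := fun z e => z (g e)
    have hr2 : Measurable r2 := measurable_pi_iff.2 fun e => measurable_pi_apply _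
    have hcomp : (I.restrict (π := fun _ => ℤ)) ∘ (Subtype.val : GradConf G → G.Dart → ℤ)
        = r2 ∘ r := by
      funext η e
      simp [r2, r, hg]
    change (μ.map Subtype.val).map I.restrict = (ν.map Subtype.val).map I.restrict
    rw [Measure.map_map (mr I) measurable_subtype_coe,
      Measure.map_map (mr I) measurable_subtype_coe, hcomp, ← Measure.map_map hr2 hr, hreq,
      Measure.map_map hr2 hr]

end swap
section constr
variable {V : Type*} {G : SimpleGraph V}
variable {d : ℕ} {Q : ℤ → ℝ} {q : ℕ} [NeZero q] {lam : ℤ → ℝ}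

/-- A probability mass function from nonnegative reals summing to one. -/
def pmfOfReal {α : Type*} (f : α → ℝ) (h0 : ∀ a, 0 ≤ f a) (h1 : HasSum f 1) : PMF α :=
  ⟨fun a => ENNReal.ofReal (f a), by
    rw [ENNReal.summable.hasSum_iff, ← ENNReal.ofReal_tsum_of_nonneg h0 h1.summable, h1.tsum_eq,
      ENNReal.ofReal_one]⟩

theorem step_hasSum (hQ : IsSymmTransferOperator Q) (hQ1 : Summable Q)
    (hb : IsBoundaryLaw d Q lam) (i : ZMod q) :
    HasSum (fun p : ZMod q × ℤ => fuzzyP Q q lam i p.1 * incrLaw Q q p.2 (p.1 - i)) 1 := by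
  have h : ∀ j : ZMod q, HasSum (fun l : ℤ => fuzzyP Q q lam i j * incrLaw Q q l (j - i))
      (fuzzyP Q q lam i j) := fun j => by
    simpa using (incrLaw_hasSum hQ hQ1 (j - i)).mul_left (fuzzyP Q q lam i j)
  have hs : Summable (fun p : ZMod q × ℤ =>
      fuzzyP Q q lam i p.1 * incrLaw Q q p.2 (p.1 - i)) := by
    rw [summable_prod_of_nonneg fun p =>
      mul_nonneg (fuzzyP_nonneg hQ hQ1 hb _ _) (incrLaw_nonneg hQ hQ1 _ _)]
    exact ⟨fun j => (h j).summable, Summable.of_finite⟩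
  have e := (hs.hasSum.prod_fiberwise h).unique (hasSum_fintype _)
  rw [fuzzyP_sum hQ hQ1 hb] at e
  exact e ▸ hs.hasSum

/-- The fuzzy chain run along the tree away from `w`, driven by random transition maps. -/
def chainAux (par : V → V) (ω : ZMod q × (V × ZMod q → ZMod q × ℤ)) : ℕ → V → ZMod q
  | 0, _ => ω.1
  | n + 1, y => (ω.2 (y, chainAux par ω n (par y))).1

theorem measurable_eval [MeasurableSpace (ZMod q)] [MeasurableSingletonClass (ZMod q)]
    {Ω : Type*} [MeasurableSpace Ω] {X : Ω → V × ZMod q → ZMod q × ℤ} (hX : Measurable X)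
    (y : V) {g : Ω → ZMod q} (hg : Measurable g) : Measurable fun ω => X ω (y, g ω) := by
  have : Measurable (fun p : ZMod q × Ω => X p.2 (y, p.1)) :=
    measurable_from_prod_countable_right fun s =>
      show Measurable fun ω => X ω (y, s) from (measurable_pi_apply (y, s)).comp hX
  exact this.comp (hg.prodMk measurable_id)

open Classical in
theorem exists_rooted (hG : G.IsTree) (hQ : IsSymmTransferOperator Q) (hQ1 : Summable Q)
    (hb : IsBoundaryLaw d Q lam) (w : V) :
    ∃ ν : Measure (GradConf G), IsProbabilityMeasure ν ∧
      ∀ (Λ : Finset V) (hw : w ∈ Λ), (G.induce (Λ : Set V)).Connected → ∀ ζ : GradConf G,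
        ν.real (gradCylinder G Λ ζ) = gradMarginal G d Q q lam Λ w hw ζ := by
  let _inst : MeasurableSpace (ZMod q) := ⊤
  have _ : MeasurableSingletonClass (ZMod q) := ⟨fun _ => trivial⟩
  let α : PMF (ZMod q) := pmfOfReal (fuzzyStat d q lam) (fuzzyStat_nonneg hb)
    (by rw [← fuzzyStat_sum (d := d) (q := q) hb]; exact hasSum_fintype _)
  let st : ZMod q → PMF (ZMod q × ℤ) := fun i => pmfOfReal _
    (fun p => mul_nonneg (fuzzyP_nonneg hQ hQ1 hb i p.1) (incrLaw_nonneg hQ hQ1 p.2 (p.1 - i)))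
    (step_hasSum hQ hQ1 hb i)
  let M : Measure (V × ZMod q → ZMod q × ℤ) := Measure.infinitePi fun p => (st p.2).toMeasure
  let P : Measure (ZMod q × (V × ZMod q → ZMod q × ℤ)) := α.toMeasure.prod M
  let par : V → V := fun y =>
    if h : ∃ x, G.Adj x y ∧ G.dist w y = G.dist w x + 1 then h.choose else y
  have hpar : ∀ x y, G.Adj x y → G.dist w y = G.dist w x + 1 → par y = x := by
    intro x y h1 h2
    have h : ∃ x, G.Adj x y ∧ G.dist w y = G.dist w x + 1 := ⟨x, h1, h2⟩
    have e : par y = h.choose := dif_pos h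
    rw [e]
    exact parent_unique hG h.choose_spec.1 h1 h.choose_spec.2 h2
  let S : (ZMod q × (V × ZMod q → ZMod q × ℤ)) → V → ZMod q := fun ω y =>
    chainAux par ω (G.dist w y) y
  have hSw : ∀ ω, S ω w = ω.1 := fun ω => by simp [S, chainAux]
  have hSstep : ∀ ω x y, G.Adj x y → G.dist w y = G.dist w x + 1 →
      S ω y = (ω.2 (y, S ω x)).1 := by
    intro ω x y h1 h2
    simp only [S]
    rw [h2, chainAux, hpar x y h1 h2]
  have hSm : ∀ y, Measurable fun ω => S ω y := by
    intro y
    suffices ∀ n y, Measurable fun ω => chainAux (q := q) par ω n y from this _ _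
    intro n
    induction n with
    | zero => exact fun y => measurable_fst
    | succ n ih => exact fun y => (measurable_eval measurable_snd y (ih (par y))).fst
  let D : (ZMod q × (V × ZMod q → ZMod q × ℤ)) → G.Dart → ℤ := fun ω e =>
    if G.dist w e.snd = G.dist w e.fst + 1 then (ω.2 (e.snd, S ω e.fst)).2
    else - (ω.2 (e.fst, S ω e.snd)).2
  have hDm : Measurable D := by
    refine measurable_pi_iff.2 fun e => ?_
    simp only [D]
    split_ifs
    · exact (measurable_eval measurable_snd _ (hSm _)).snd
    · exact (measurable_eval measurable_snd _ (hSm _)).snd.neg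
  have hDa : ∀ ω e, D ω e.symm = - D ω e := by
    intro ω e
    have hh : e.symm.fst = e.snd := rfl
    have hh' : e.symm.snd = e.fst := rfl
    simp only [D, hh, hh']
    rcases hG.dist_eq_dist_add_one_of_adj w e.adj with h | h
    · rw [if_pos h, if_neg (by omega), neg_neg]
    · rw [if_pos h, if_neg (by omega)]
  let T : (ZMod q × (V × ZMod q → ZMod q × ℤ)) → GradConf G := fun ω => ⟨D ω, hDa ω⟩
  have hT : Measurable T := hDm.subtype_mk
  refine ⟨P.map T, Measure.isProbabilityMeasure_map hT.aemeasurable, ?_⟩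
  intro Λ hw hΛ ζ
  have hcyl : MeasurableSet (gradCylinder G Λ ζ) := by
    have : gradCylinder G Λ ζ = ⋂ e : DartsIn G Λ, {η | η.1 e.incl = ζ.1 e.incl} := by
      ext; simp [gradCylinder]
    rw [this]
    exact MeasurableSet.iInter fun e => ((measurable_pi_apply (e.incl)).comp
      measurable_subtype_coe) (measurableSet_singleton _)
  rw [map_measureReal_apply hT hcyl]
  -- decompose according to the states in `Λ`
  let I : (VertIn Λ → ZMod q) → Finset (V × ZMod q) := fun σ =>
    (outDarts G Λ w).image fun e => ((e.snd : V), σ e.fst)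
  let t : (VertIn Λ → ZMod q) → V × ZMod q → Set (ZMod q × ℤ) := fun σ p =>
    {v | ∀ e ∈ outDarts G Λ w, ((e.snd : V), σ e.fst) = p → v = (σ e.snd, ζ.1 e.incl)}
  let E : (VertIn Λ → ZMod q) → Set (ZMod q × (V × ZMod q → ZMod q × ℤ)) := fun σ =>
    {σ ⟨w, hw⟩} ×ˢ (Set.pi (I σ) (t σ))
  have hE : ∀ σ ω, ω ∈ E σ ↔ ω.1 = σ ⟨w, hw⟩ ∧ ∀ e ∈ outDarts G Λ w,
      ω.2 ((e.snd : V), σ e.fst) = (σ e.snd, ζ.1 e.incl) := by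
    intro σ ω
    simp only [E, Set.mem_prod, Set.mem_singleton_iff, Set.mem_pi]
    refine and_congr_right fun _ => ⟨fun h e he => ?_, fun h p _ e he hp => ?_⟩
    · exact h _ (Finset.mem_coe.2 (Finset.mem_image_of_mem _ he)) e he rfl
    · rw [← hp]; exact h e he
  have hES : ∀ σ ω, ω ∈ E σ → ∀ y : VertIn Λ, S ω y = σ y := by
    intro σ ω h
    rw [hE] at h
    suffices ∀ n, ∀ y : VertIn Λ, G.dist w (y : V) = n → S ω y = σ y from fun y => this _ y rfl
    intro n
    induction n with
    | zero =>
      intro y hy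
      have : y = ⟨w, hw⟩ := Subtype.ext (hG.connected.dist_eq_zero_iff.1 hy).symm
      rw [this]; exact (hSw ω).trans h.1
    | succ n ih =>
      intro y hy
      have hne : y ≠ ⟨w, hw⟩ := by
        rintro rfl
        simp at hy
      obtain ⟨x, hx1, hx2⟩ := exists_parent hG hΛ hne
      rw [hSstep ω x y hx1 hx2, ih x (by simp only at hx2; omega)]
      have := h.2 (⟨(x, y), hx1⟩ : DartsIn G Λ) (mem_outDarts.2 hx2)
      exact congrArg Prod.fst this
  have hun : T ⁻¹' gradCylinder G Λ ζ = ⋃ σ ∈ (Finset.univ : Finset (VertIn Λ → ZMod q)), E σ := by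
    ext ω
    simp only [Set.mem_preimage, Finset.mem_univ, Set.iUnion_true, Set.mem_iUnion]
    constructor
    · intro h
      refine ⟨fun y => S ω y, (hE (fun y => S ω y) ω).2 ⟨(hSw ω).symm, fun e he => ?_⟩⟩
      have ho := mem_outDarts.1 he
      have h1 : D ω e.incl = ζ.1 e.incl := h e
      simp only [D] at h1
      rw [if_pos (show G.dist w e.incl.snd = G.dist w e.incl.fst + 1 from ho)] at h1
      refine Prod.ext (hSstep ω _ _ e.adj ho).symm h1
    · rintro ⟨σ, h⟩ e
      have hS := hES σ ω h
      have key : ∀ f ∈ outDarts G Λ w, D ω f.incl = ζ.1 f.incl := by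
        intro f hf
        have ho := mem_outDarts.1 hf
        simp only [D]
        rw [if_pos (show G.dist w f.incl.snd = G.dist w f.incl.fst + 1 from ho)]
        have h2 := ((hE _ _).1 h).2 f hf
        rw [← hS f.fst] at h2
        exact congrArg Prod.snd h2
      change D ω e.incl = ζ.1 e.incl
      rcases hG.dist_eq_dist_add_one_of_adj w (show G.Adj (e.fst : V) e.snd from e.adj) with ho | ho
      · have := key e.symm (mem_outDarts.2 ho)
        have e1 : DartsIn.incl e.symm = e.incl.symm := rfl
        rw [e1, hDa, ζ.2] at this
        exact neg_injective this
      · exact key e (mem_outDarts.2 ho)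
  have hEm : ∀ σ, MeasurableSet (E σ) := fun σ =>
    (measurableSet_singleton _).prod (MeasurableSet.pi (Finset.countable_toSet _)
      fun p _ => (Set.to_countable _).measurableSet)
  rw [hun, measureReal_biUnion_finset ?_ fun σ _ => hEm σ, gradMarginal_eq]
  · refine Finset.sum_congr rfl fun σ _ => ?_
    have hinj : Set.InjOn (fun e : DartsIn G Λ => ((e.snd : V), σ e.fst)) (outDarts G Λ w) := by
      intro e he e' he' h
      exact outDarts_unique hG he he' (Subtype.ext (congrArg Prod.fst h))
    have ht : ∀ e ∈ outDarts G Λ w, t σ ((e.snd : V), σ e.fst) = {(σ e.snd, ζ.1 e.incl)} := by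
      intro e he
      ext v
      simp only [t, Set.mem_ofPred_eq, Set.mem_singleton_iff]
      refine ⟨fun h => h e he rfl, fun h e' he' hp => ?_⟩
      rw [hinj he' he hp]; exact h
    have hM : M (Set.pi (I σ) (t σ)) = ∏ e ∈ outDarts G Λ w, ENNReal.ofReal
        (fuzzyP Q q lam (σ e.fst) (σ e.snd) * incrLaw Q q (ζ.1 e.incl) (σ e.snd - σ e.fst)) := by
      rw [Measure.infinitePi_pi _ fun p _ => (Set.to_countable _).measurableSet,
        Finset.prod_image hinj]
      refine Finset.prod_congr rfl fun e he => ?_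
      rw [ht e he, PMF.toMeasure_apply_singleton _ _ (measurableSet_singleton _)]
      rfl
    have hP : P (E σ) = ENNReal.ofReal (wt G d Q q lam Λ ζ σ ⟨w, hw⟩) := by
      rw [Measure.prod_prod, hM, PMF.toMeasure_apply_singleton _ _ (measurableSet_singleton _), wt,
        ENNReal.ofReal_mul (fuzzyStat_nonneg hb _), ENNReal.ofReal_prod_of_nonneg]
      · rfl
      · exact fun e _ => mul_nonneg (fuzzyP_nonneg hQ hQ1 hb _ _) (incrLaw_nonneg hQ hQ1 _ _)
    rw [measureReal_def, hP, ENNReal.toReal_ofReal]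
    exact mul_nonneg (fuzzyStat_nonneg hb _) (Finset.prod_nonneg fun e _ =>
      mul_nonneg (fuzzyP_nonneg hQ hQ1 hb _ _) (incrLaw_nonneg hQ hQ1 _ _))
  · intro σ _ σ' _ hne
    refine Set.disjoint_left.2 fun ω h h' => hne ?_
    funext y
    rw [← hES σ ω h y, hES σ' ω h' y]

/-- The finite-volume marginals determine exactly one probability measure. -/
theorem existsUnique_gradMeasure (hG : G.IsTree) (hd : 1 ≤ d) (hQ : IsSymmTransferOperator Q)
    (hQ1 : Summable Q) (hb : IsBoundaryLaw d Q lam) (hp : Function.Periodic lam (q : ℤ)) :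
    ∃! ν : Measure (GradConf G), IsGradMeasure G d Q q lam ν := by
  classical
  obtain ⟨w0⟩ := hG.connected.nonempty
  obtain ⟨ν, hν, hm⟩ := exists_rooted (q := q) hG hQ hQ1 hb w0
  refine ⟨ν, ⟨hν, fun Λ w hw hΛ ζ => ?_⟩, fun μ hμ => ?_⟩
  · obtain ⟨μ, hμ, hm'⟩ := exists_rooted (q := q) hG hQ hQ1 hb w
    have : ν = μ := by
      refine ext_gradCylinder hG {w0, w} (by simp) ν μ fun Λ' hs hc ζ' => ?_
      rw [hm Λ' (hs (by simp)) hc, hm' Λ' (hs (by simp)) hc]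
      exact gradMarginal_root hG hd hQ hQ1 hb hp Λ' hc ζ' _ _ _ _
    rw [this]
    exact hm' Λ hw hΛ ζ
  · have := hμ.prob
    refine ext_gradCylinder hG {w0} (by simp) μ ν fun Λ' hs hc ζ' => ?_
    rw [hm Λ' (hs (by simp)) hc, hμ.marginal Λ' w0 (hs (by simp)) hc]

/-- The gradient Gibbs measure of a periodic boundary law has the prescribed marginals. -/
theorem isGradMeasure_gradMeasure (hG : G.IsTree) (hd : 1 ≤ d) (hQ : IsSymmTransferOperator Q)
    (hQ1 : Summable Q) (hb : IsBoundaryLaw d Q lam) (hp : Function.Periodic lam (q : ℤ)) :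
    IsGradMeasure G d Q q lam (gradMeasure G d Q q lam) := by
  have h := (existsUnique_gradMeasure hG hd hQ hQ1 hb hp).exists
  rw [gradMeasure, dif_pos h]
  exact h.choose_spec

end constr

end

end TreeGradient

open MeasureTheory

namespace TreeGradient

/-! The measure is tested on closed height profiles along a geodesic ray of the tree: the height
starts at 0, runs through an arbitrary finite list of integers and returns to 0. A prescribed height
profile determines the fuzzy chain up to its starting state `s`, so the marginal is a sum over `s`.
Write S(k) = ∑ Q_q(k - t) λ(t) for the normalisation of the transition matrix. Each edge contributes
Q times λ at its far end over S at its near end. Because the profile closes up, these quotients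
regroup by height (`prod_loopHeight`): apart from a factor in Q common to both boundary laws, the
term of `s` is a positive weight times the product of λ(s + j)/S(s + j) over the list.

As a function of the list this product is multiplicative, hence a character of the free monoid on ℤ.
Equal measures therefore give two equal positive combinations of characters, and by Dedekind's
independence of characters each character of one side occurs on the other (`exists_character_eq`).
Evaluated on one-letter words, this gives a shift `s` with λ₁(s + j)/S₁(s + j) = λ₂(j)/S₂(j) for all
j.

The boundary law equation λ = c S^d turns λ/S into c S^(d-1). As d ≥ 2, the exponent is nonzero, so
S₁ shifted by `s` is proportional to S₂, and then so are the boundary laws. Shifts and positive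
factors preserve the minimal period, whence q₁ = q₂. -/

/-! ### Independence of characters. -/

/-- If two finite linear combinations of characters agree and the second one has positive
coefficients, then each character of the second one occurs in the first one. -/
theorem exists_character_eq {M ι κ : Type*} [Monoid M] [Fintype ι] [Fintype κ]
    (χ : ι → M →* ℝ) (ψ : κ → M →* ℝ) (a : ι → ℝ) (b : κ → ℝ) (hb : ∀ k, 0 < b k)
    (h : ∀ m, ∑ i, a i * χ i m = ∑ k, b k * ψ k m) (k : κ) : ∃ i, χ i = ψ k := by
  classical
  by_contra! hne
  have hli := linearIndependent_monoidHom M ℝ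
  let f : (M →* ℝ) →₀ ℝ :=
    ∑ k, Finsupp.single (ψ k) (b k) - ∑ i, Finsupp.single (χ i) (a i)
  have hf : f = 0 := by
    refine linearIndependent_iff.1 hli f ?_
    funext m
    simp [f, map_sub, map_sum, Finsupp.linearCombination_single, h m]
  -- No χ i equals ψ k, so only the second family contributes. Coinciding characters there cannot
  -- cancel, as their coefficients are positive.
  have h0 : f (ψ k) = ∑ k', if ψ k' = ψ k then b k' else 0 := by
    simp [f, Finsupp.single_apply, hne]
  have hpos : 0 < ∑ k', if ψ k' = ψ k then b k' else 0 :=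
    Finset.sum_pos' (fun k' _ => by split_ifs; exacts [(hb k').le, le_rfl])
      ⟨k, Finset.mem_univ k, by simpa using hb k⟩
  rw [← h0, hf] at hpos
  exact lt_irrefl _ hpos

/-! ### Geodesic rays and their initial segments. -/

section ray

variable {V : Type*} {G : SimpleGraph V}

/-- Every vertex has at least two neighbours, and at most one of them, the parent, is nearer to the
root. -/
theorem exists_farther_neighbor [G.LocallyFinite] {d : ℕ} (hd : 1 ≤ d) (hG : IsCayleyTree G d)
    (w x : V) : ∃ y, G.Adj x y ∧ G.dist w y = G.dist w x + 1 := by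
  have hdeg : 1 < (G.neighborFinset x).card := by
    rw [SimpleGraph.card_neighborFinset_eq_degree, hG.2.degree_eq]
    omega
  obtain ⟨y, hy, z, hz, hyz⟩ := Finset.one_lt_card.1 hdeg
  rw [SimpleGraph.mem_neighborFinset] at hy hz
  rcases hG.1.dist_eq_dist_add_one_of_adj w hy with h | h
  · rcases hG.1.dist_eq_dist_add_one_of_adj w hz with h' | h'
    · exact absurd (parent_unique hG.1 hy.symm hz.symm h h') hyz
    · exact ⟨z, hz, h'⟩
  · exact ⟨y, hy, h⟩

/-- A Cayley tree contains a geodesic ray. -/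
theorem exists_ray [G.LocallyFinite] {d : ℕ} (hd : 1 ≤ d) (hG : IsCayleyTree G d) :
    ∃ v : ℕ → V, (∀ n, G.Adj (v n) (v (n + 1))) ∧ ∀ n, G.dist (v 0) (v n) = n := by
  obtain ⟨w⟩ := hG.1.connected.nonempty
  choose g hg using exists_farther_neighbor hd hG w
  refine ⟨fun n => g^[n] w, fun n => ?_, fun n => ?_⟩
  · simpa only [Function.iterate_succ_apply'] using (hg (g^[n] w)).1
  · induction n with
    | zero => simp
    | succ n ih =>
      simp only [Function.iterate_zero, id_eq, Function.iterate_succ_apply'] at ih ⊢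
      rw [(hg _).2, ih]

open Classical in
/-- The initial segment of a sequence of vertices, up to and including the index `n`. -/
noncomputable def segment (v : ℕ → V) (n : ℕ) : Finset V := (Finset.range (n + 1)).image v

theorem mem_segment {v : ℕ → V} {n : ℕ} {x : V} : x ∈ segment v n ↔ ∃ i ≤ n, v i = x := by
  simp [segment]

theorem segment_connected {v : ℕ → V} (hv : ∀ n, G.Adj (v n) (v (n + 1))) (n : ℕ) :
    (G.induce (segment v n : Set V)).Connected := by
  have hmem : ∀ i ≤ n, v i ∈ (segment v n : Set V) := fun i hi =>
    Finset.mem_coe.2 (mem_segment.2 ⟨i, hi, rfl⟩)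
  rw [SimpleGraph.connected_iff_exists_forall_reachable]
  refine ⟨⟨v 0, hmem 0 (Nat.zero_le n)⟩, ?_⟩
  have key : ∀ i (hi : i ≤ n), (G.induce (segment v n : Set V)).Reachable
      ⟨v 0, hmem 0 (Nat.zero_le n)⟩ ⟨v i, hmem i hi⟩ := by
    intro i
    induction i with
    | zero => exact fun _ => .rfl
    | succ i ih =>
      intro hi
      refine (ih (by omega)).trans (SimpleGraph.Adj.reachable ?_)
      exact hv i
  rintro ⟨x, hx⟩
  obtain ⟨i, hi, rfl⟩ := mem_segment.1 (Finset.mem_coe.1 hx)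
  exact key i hi

/-- Along a geodesic, distance from the start is the index, so an outward edge joins consecutive
vertices and is identified by the distance of its first end. -/
theorem prod_outDarts_segment {M : Type*} [CommMonoid M] {v : ℕ → V}
    (hv : ∀ n, G.Adj (v n) (v (n + 1))) (hdist : ∀ n, G.dist (v 0) (v n) = n) (n : ℕ)
    (f : V → V → M) :
    ∏ e ∈ outDarts G (segment v n) (v 0), f e.fst e.snd
      = ∏ i ∈ Finset.range n, f (v i) (v (i + 1)) := by
  have hvert : ∀ x : VertIn (segment v n), ∃ i ≤ n, v i = x := fun x =>
    mem_segment.1 (Finset.mem_coe.1 x.2)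
  have hform : ∀ e ∈ outDarts G (segment v n) (v 0), ∃ i < n, v i = e.fst ∧ v (i + 1) = e.snd := by
    intro e he
    rw [mem_outDarts] at he
    obtain ⟨i, hi, hi'⟩ := hvert e.fst
    obtain ⟨j, hj, hj'⟩ := hvert e.snd
    rw [← hi', ← hj', hdist, hdist] at he
    subst he
    exact ⟨i, by omega, hi', hj'⟩
  refine Finset.prod_nbij (fun e => G.dist (v 0) (e.fst : V)) ?_ ?_ ?_ ?_
  · intro e he
    obtain ⟨i, hi, h1, -⟩ := hform e he
    simpa [← h1, hdist] using hi
  · intro e he e' he' h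
    obtain ⟨i, hi, h1, h2⟩ := hform e he
    obtain ⟨j, hj, h3, h4⟩ := hform e' he'
    simp only [← h1, ← h3, hdist] at h
    subst h
    exact SimpleGraph.Dart.ext _ _ (Prod.ext (Subtype.ext (h1.symm.trans h3))
      (Subtype.ext (h2.symm.trans h4)))
  · intro i hi
    have hi : i < n := by simpa using hi
    have hm : ∀ j ≤ n, v j ∈ (segment v n : Set V) := fun j hj =>
      Finset.mem_coe.2 (mem_segment.2 ⟨j, hj, rfl⟩)
    refine ⟨⟨(⟨v i, hm i hi.le⟩, ⟨v (i + 1), hm _ hi⟩), hv i⟩, ?_, hdist i⟩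
    rw [Finset.mem_coe, mem_outDarts]
    simp [hdist]
  · intro e he
    obtain ⟨i, hi, h1, h2⟩ := hform e he
    simp [← h1, ← h2, hdist]

end ray

/-! ### Marginals at gradients of height functions. -/

section marginal

variable {V : Type*} {G : SimpleGraph V}

/-- The gradient configuration of a height function. -/
def heightGrad (G : SimpleGraph V) (h : V → ℤ) : GradConf G :=
  ⟨fun e => h e.snd - h e.fst, fun e => by simp⟩

variable {d : ℕ} {Q : ℤ → ℝ} {q : ℕ} [NeZero q] {lam : ℤ → ℝ}

/-- The weight with which a `q`-periodic boundary law passes its mass to one child. -/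
noncomputable def fuzzySum (Q : ℤ → ℝ) (q : ℕ) [NeZero q] (lam : ℤ → ℝ) (k : ZMod q) : ℝ :=
  ∑ s : ZMod q, Qmod Q q (k - s) * onResidues q lam s

/-- The factor `Qmod` in the transition probability cancels, by symmetry of Q, against the
normalisation of the increment law. -/
theorem fuzzyP_mul_incrLaw (hQ : IsSymmTransferOperator Q) (hQ1 : Summable Q) (i j : ZMod q)
    (l : ℤ) (h : (l : ZMod q) = j - i) :
    fuzzyP Q q lam i j * incrLaw Q q l (j - i) =
      Q l * (onResidues q lam j / fuzzySum Q q lam i) := by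
  have hne := (Qmod_pos hQ hQ1 (i - j)).ne'
  rw [incrLaw, if_pos h, ← neg_sub i j, Qmod_neg hQ, fuzzyP, ← fuzzySum]
  field_simp

/-- The marginal at the gradient of a height function: the fuzzy chain is determined by a
global shift. -/
theorem gradMarginal_heightGrad (hG : G.IsTree) (hQ : IsSymmTransferOperator Q)
    (hQ1 : Summable Q) (Λ : Finset V) (w : V) (hw : w ∈ Λ)
    (hΛ : (G.induce (Λ : Set V)).Connected) (h : V → ℤ) (hw0 : h w = 0) :
    gradMarginal G d Q q lam Λ w hw (heightGrad G h) =
      ∑ s : ZMod q, fuzzyStat d q lam s * ∏ e ∈ outDarts G Λ w,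
        (Q (h e.snd - h e.fst) * (onResidues q lam (s + (h e.snd : ℤ)) /
          fuzzySum Q q lam (s + (h e.fst : ℤ)))) := by
  classical
  rw [gradMarginal_eq]
  symm
  refine Finset.sum_of_injOn (fun s x => s + (h x : ZMod q)) ?_ (by simp) ?_ ?_
  · intro s _ t _ hst
    simpa using congrFun hst ⟨w, hw⟩
  · intro σ _ hσ
    -- A nonzero term forces every fuzzy increment to be the residue of the height increment.
    -- Induction on the distance from `w` then identifies σ with the height shifted by its value at
    -- `w`.
    by_contra hne
    have hne' := right_ne_zero_of_mul hne
    rw [Finset.prod_ne_zero_iff] at hne'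
    have hinc : ∀ e ∈ outDarts G Λ w,
        σ e.snd - σ e.fst = (h e.snd : ZMod q) - (h e.fst : ZMod q) := by
      intro e he
      have h1 := right_ne_zero_of_mul (hne' e he)
      rw [incrLaw] at h1
      have h2 := (ite_ne_right_iff.1 h1).1
      rw [← h2]
      exact Int.cast_sub _ _
    refine hσ ⟨σ ⟨w, hw⟩, by simp, ?_⟩
    suffices ∀ n, ∀ y : VertIn Λ, G.dist w (y : V) = n →
        σ ⟨w, hw⟩ + (h y : ZMod q) = σ y from funext fun y => this _ y rfl
    intro n
    induction n with
    | zero =>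
      intro y hy
      have : y = ⟨w, hw⟩ := Subtype.ext (hG.connected.dist_eq_zero_iff.1 hy).symm
      subst this
      simp [hw0]
    | succ n ih =>
      intro y hy
      have hyw : y ≠ ⟨w, hw⟩ := by
        rintro rfl
        simp at hy
      obtain ⟨x, hx1, hx2⟩ := exists_parent hG hΛ hyw
      have h1 := hinc (⟨(x, y), hx1⟩ : DartsIn G Λ) (mem_outDarts.2 hx2)
      have h2 := ih x (by simp only at hx2; omega)
      simp only at h1
      linear_combination h2 - h1
  · intro s _
    rw [wt]
    congr 1
    · simp [hw0]
    · refine Finset.prod_congr rfl fun e _ => ?_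
      symm
      refine fuzzyP_mul_incrLaw hQ hQ1 _ _ _ ?_
      simp [heightGrad, DartsIn.incl]

/-! ### Closed height profiles and characters of the free monoid. -/

/-- Heights along a path that starts and ends at height zero and follows the list `l`. -/
def loopHeight (l : List ℤ) (i : ℕ) : ℤ := (0 :: l).getD i 0

theorem prod_loopHeight (l : List ℤ) (f g : ℤ → ℝ) :
    ∏ i ∈ Finset.range (l.length + 1), (f (loopHeight l (i + 1)) / g (loopHeight l i)) =
      f 0 / g 0 * (l.map fun j => f j / g j).prod := by
  have hl : ∀ i, loopHeight l (i + 1) = l.getD i 0 := fun i => by simp [loopHeight]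
  -- Split off the last numerator and the first denominator: both sit at height 0. The remaining
  -- numerators and denominators then run over the same list entries.
  rw [Finset.prod_div_distrib, Finset.prod_range_succ, Finset.prod_range_succ' _ l.length]
  have hp : ∀ F : ℤ → ℝ, (l.map F).prod =
      ∏ i ∈ Finset.range l.length, F (loopHeight l (i + 1)) := by
    intro F
    rw [← Fin.prod_univ_eq_prod_range (fun i => F (loopHeight l (i + 1))), ← List.prod_ofFn]
    congr 1
    refine List.ext_getElem (by simp) fun i _ _ => ?_
    simp [hl]
  rw [hp, Finset.prod_div_distrib]
  have h0 : loopHeight l 0 = 0 := rfl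
  -- This index is just past the end of the list; the default value 0 closes the profile.
  have h1 : loopHeight l (l.length + 1) = 0 := by simp [hl]
  rw [h0, h1]
  ring

/-- The character of the free monoid over the heights that belongs to a starting state. -/
noncomputable def heightChar (Q : ℤ → ℝ) (q : ℕ) [NeZero q] (lam : ℤ → ℝ) (s : ZMod q) :
    FreeMonoid ℤ →* ℝ :=
  FreeMonoid.lift fun j : ℤ => onResidues q lam (s + j) / fuzzySum Q q lam (s + j)

/-- The Q factor does not depend on the boundary law, so it can be cancelled when two marginals are
compared. -/
theorem gradMarginal_segment (hG : G.IsTree) (hQ : IsSymmTransferOperator Q) (hQ1 : Summable Q)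
    {v : ℕ → V} (hv : ∀ n, G.Adj (v n) (v (n + 1))) (hdist : ∀ n, G.dist (v 0) (v n) = n)
    (l : List ℤ) (hw : v 0 ∈ segment v (l.length + 1)) :
    gradMarginal G d Q q lam (segment v (l.length + 1)) (v 0) hw
        (heightGrad G fun x => loopHeight l (G.dist (v 0) x)) =
      (∏ i ∈ Finset.range (l.length + 1), Q (loopHeight l (i + 1) - loopHeight l i)) *
        ∑ s : ZMod q, fuzzyStat d q lam s * (onResidues q lam s / fuzzySum Q q lam s) *
          heightChar Q q lam s (FreeMonoid.ofList l) := by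
  rw [gradMarginal_heightGrad hG hQ hQ1 _ _ hw (segment_connected hv _) _ (by simp [loopHeight]),
    Finset.mul_sum]
  refine Finset.sum_congr rfl fun s _ => ?_
  rw [prod_outDarts_segment hv hdist _ fun x y =>
    (Q (loopHeight l (G.dist (v 0) y) - loopHeight l (G.dist (v 0) x)) *
      (onResidues q lam (s + (loopHeight l (G.dist (v 0) y) : ℤ)) /
        fuzzySum Q q lam (s + (loopHeight l (G.dist (v 0) x) : ℤ))))]
  simp only [hdist]
  rw [Finset.prod_mul_distrib, prod_loopHeight l (fun j => onResidues q lam (s + (j : ℤ)))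
    fun j => fuzzySum Q q lam (s + (j : ℤ)), heightChar, FreeMonoid.lift_apply]
  simp only [Int.cast_zero, add_zero, FreeMonoid.toList_ofList]
  ring

theorem fuzzyStat_pos (hb : IsBoundaryLaw d Q lam) (i : ZMod q) : 0 < fuzzyStat d q lam i :=
  div_pos (Real.rpow_pos_of_pos (onResidues_pos hb i) _) (fuzzyStat_den_pos hb)

theorem exists_onResidues_eq (hQ1 : Summable Q) (hb : IsBoundaryLaw d Q lam)
    (hp : Function.Periodic lam (q : ℤ)) :
    ∃ c : ℝ, 0 < c ∧ ∀ k : ZMod q, onResidues q lam k = c * fuzzySum Q q lam k ^ d := by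
  obtain ⟨c, hc, he⟩ := hb.eqn
  refine ⟨c, hc, fun k => ?_⟩
  rw [fuzzySum, fuzzySum_eq hQ1 hp]
  exact he _

end marginal

/-! ### Comparison of two boundary laws. -/

/-- Equal gradient Gibbs measures: up to a shift, the boundary laws are proportional. -/
theorem exists_shift_of_gradMeasure_eq {V : Type*} (G : SimpleGraph V) [G.LocallyFinite] (d : ℕ)
    (hd : 2 ≤ d) (hG : IsCayleyTree G d) (Q : ℤ → ℝ) (hQ : IsSymmTransferOperator Q)
    (hQ1 : Summable Q) (q₁ q₂ : ℕ) [NeZero q₁] [NeZero q₂] (lam₁ lam₂ : ℤ → ℝ)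
    (hb₁ : IsBoundaryLaw d Q lam₁) (hb₂ : IsBoundaryLaw d Q lam₂)
    (hp₁ : Function.Periodic lam₁ (q₁ : ℤ)) (hp₂ : Function.Periodic lam₂ (q₂ : ℤ))
    (hν : gradMeasure G d Q q₁ lam₁ = gradMeasure G d Q q₂ lam₂) :
    ∃ s : ZMod q₁, ∃ c : ℝ, 0 < c ∧ ∀ i : ℤ, lam₂ i = c * onResidues q₁ lam₁ (i + s) := by
  have hd1 : 1 ≤ d := by omega
  obtain ⟨v, hv, hdist⟩ := exists_ray hd1 hG
  have hm₁ := isGradMeasure_gradMeasure (q := q₁) hG.1 hd1 hQ hQ1 hb₁ hp₁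
  have hm₂ := isGradMeasure_gradMeasure (q := q₂) hG.1 hd1 hQ hQ1 hb₂ hp₂
  -- One character of the second family suffices; the one started at state 0 is matched with some
  -- state `s` of the first.
  obtain ⟨s, hs⟩ := exists_character_eq (heightChar Q q₁ lam₁) (heightChar Q q₂ lam₂)
    (fun s => fuzzyStat d q₁ lam₁ s * (onResidues q₁ lam₁ s / fuzzySum Q q₁ lam₁ s))
    (fun s => fuzzyStat d q₂ lam₂ s * (onResidues q₂ lam₂ s / fuzzySum Q q₂ lam₂ s))
    (fun s => mul_pos (fuzzyStat_pos hb₂ s)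
      (div_pos (onResidues_pos hb₂ s) (fuzzySum_pos hQ hQ1 hb₂ s)))
    (fun l => by
      have hw : v 0 ∈ segment v (l.toList.length + 1) :=
        mem_segment.2 ⟨0, Nat.zero_le _, rfl⟩
      have h₁ := hm₁.marginal _ _ hw (segment_connected hv _)
        (heightGrad G fun x => loopHeight l.toList (G.dist (v 0) x))
      have h₂ := hm₂.marginal _ _ hw (segment_connected hv _)
        (heightGrad G fun x => loopHeight l.toList (G.dist (v 0) x))
      rw [hν, h₂, gradMarginal_segment hG.1 hQ hQ1 hv hdist,
        gradMarginal_segment hG.1 hQ hQ1 hv hdist] at h₁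
      exact (mul_left_cancel₀ (Finset.prod_pos fun i _ => hQ.pos _).ne' h₁).symm) 0
  obtain ⟨c₁, hc₁, he₁⟩ := exists_onResidues_eq (q := q₁) hQ1 hb₁ hp₁
  obtain ⟨c₂, hc₂, he₂⟩ := exists_onResidues_eq (q := q₂) hQ1 hb₂ hp₂
  have hS₁ : ∀ k, 0 < fuzzySum Q q₁ lam₁ k := fun k => fuzzySum_pos hQ hQ1 hb₁ k
  have hS₂ : ∀ k, 0 < fuzzySum Q q₂ lam₂ k := fun k => fuzzySum_pos hQ hQ1 hb₂ k
  -- Here d ≥ 2 is essential: the exponent d - 1 = n + 1 is positive. For d = 1 the quotient λ/S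
  -- would be constant and carry no information.
  obtain ⟨n, rfl⟩ : ∃ n, d = n + 2 := ⟨d - 2, by omega⟩
  have hpow : ∀ j : ℤ, c₁ * fuzzySum Q q₁ lam₁ (s + j) ^ (n + 1) =
      c₂ * fuzzySum Q q₂ lam₂ j ^ (n + 1) := by
    intro j
    have h := DFunLike.congr_fun hs (FreeMonoid.of j)
    simp only [heightChar, FreeMonoid.lift_eval_of, zero_add] at h
    rw [he₁, he₂, div_eq_div_iff (hS₁ _).ne' (hS₂ _).ne'] at h
    refine mul_right_cancel₀ (mul_pos (hS₁ (s + j)) (hS₂ j)).ne' ?_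
    linear_combination h
  have hratio : ∀ j : ℤ, fuzzySum Q q₂ lam₂ j / fuzzySum Q q₁ lam₁ (s + j) =
      fuzzySum Q q₂ lam₂ 0 / fuzzySum Q q₁ lam₁ s := by
    intro j
    have key : ∀ i : ℤ, (fuzzySum Q q₂ lam₂ i / fuzzySum Q q₁ lam₁ (s + i)) ^ (n + 1) =
        c₁ / c₂ := by
      intro i
      rw [div_pow, div_eq_div_iff (pow_pos (hS₁ _) _).ne' hc₂.ne']
      linear_combination -hpow i
    have h0 := key 0
    simp only [Int.cast_zero, add_zero] at h0
    exact (pow_left_inj₀ (div_pos (hS₂ _) (hS₁ _)).le (div_pos (hS₂ _) (hS₁ _)).le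
      n.succ_ne_zero).1 ((key j).trans h0.symm)
  -- With r the constant ratio S₂/S₁, the equations λ = c S^d give the factor (c₂/c₁) r^d.
  refine ⟨s, c₂ / c₁ * (fuzzySum Q q₂ lam₂ 0 / fuzzySum Q q₁ lam₁ s) ^ (n + 2),
    mul_pos (div_pos hc₂ hc₁) (pow_pos (div_pos (hS₂ _) (hS₁ _)) _), fun i => ?_⟩
  rw [← onResidues_intCast hp₂, add_comm (i : ZMod q₁) s, he₁, he₂, ← hratio i, div_pow]
  have := (pow_pos (hS₁ (s + i)) (n + 2)).ne'
  field_simp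

theorem HasMinimalPeriod.unique {lam : ℤ → ℝ} {p q : ℕ} (hp : HasMinimalPeriod lam p)
    (hq : HasMinimalPeriod lam q) : p = q :=
  le_antisymm (hp.2.2 q hq.1 hq.2.1) (hq.2.2 p hp.1 hp.2.1)

theorem HasMinimalPeriod.const_mul_shift {lam mu : ℤ → ℝ} {q : ℕ} (h : HasMinimalPeriod lam q)
    {c : ℝ} (hc : 0 < c) (t : ℤ) (hmu : ∀ i, mu i = c * lam (i + t)) :
    HasMinimalPeriod mu q := by
  refine ⟨h.1, fun i => ?_, fun p hp hper => h.2.2 p hp fun i => ?_⟩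
  · rw [hmu, hmu, show i + (q : ℤ) + t = i + t + q by ring, h.2.1]
  · have h1 := hper (i - t)
    rw [hmu, hmu, show i - t + (p : ℤ) + t = i + p by ring, sub_add_cancel] at h1
    exact mul_left_cancel₀ hc.ne' h1

end TreeGradient

open TreeGradient in
theorem theorem3p6 {V : Type*} (G : SimpleGraph V) [G.LocallyFinite] (d : ℕ) (hd : 2 ≤ d)
    (hG : IsCayleyTree G d) (Q : ℤ → ℝ) (hQ : IsSymmTransferOperator Q) (hQ1 : Summable Q)
    (q₁ q₂ : ℕ) [NeZero q₁] [NeZero q₂] (lam₁ lam₂ : ℤ → ℝ)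
    (hb₁ : IsBoundaryLaw d Q lam₁) (hb₂ : IsBoundaryLaw d Q lam₂)
    (hp₁ : HasMinimalPeriod lam₁ q₁) (hp₂ : HasMinimalPeriod lam₂ q₂)
    (hν : gradMeasure G d Q q₁ lam₁ = gradMeasure G d Q q₂ lam₂) :
    q₁ = q₂ ∧ ∃ ρ : Equiv.Perm (ZMod q₁), IsCyclicShift ρ ∧ ∃ c : ℝ, 0 < c ∧
      ∀ i : ℤ, lam₂ i = c * onResidues q₁ lam₁ (ρ (i : ZMod q₁)) := by
  obtain ⟨s, c, hc, h⟩ := exists_shift_of_gradMeasure_eq G d hd hG Q hQ hQ1 q₁ q₂ lam₁ lam₂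
    hb₁ hb₂ hp₁.2.1 hp₂.2.1 hν
  refine ⟨?_, Equiv.addRight s, ⟨s, fun _ => rfl⟩, c, hc, h⟩
  -- The representative `s.val` turns the rotation of residues into an integer shift.
  refine (hp₁.const_mul_shift hc (s.val : ℤ) fun i => ?_).unique hp₂
  rw [h, ← onResidues_intCast hp₁.2.1]
  simp
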